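/- Let $\mathcal H=L^2(0,1)^2$ (complex-valued functions) with norm $\|\mathbf u\|^2=\|u_1\|_{L^2(0,1)}^2+\|u_2\|_{L^2(0,1)}^2$, and let $\tilde L_0$ be the operator in $\mathcal H$ with domain $\mathcal D(\tilde L_0)=\{\mathbf u=(u_1,u_2)\in C^1[0,1]^2: u_1(0)=0\}$ given by $$\tilde L_0\mathbf u(\rho)=\bigl(-\rho u_1'(\rho)+u_2'(\rho),\; u_1'(\rho)-\rho u_2'(\rho)\bigr).$$ The operator $\tilde L_0$ is closable; let $L_0$ denote its closure. For a linear operator $A$ with domain $\mathcal D(A)\subset\mathcal H$, the spectrum $\sigma(A)$ is the set of $\lambda\in\mathbb C$ for which $\lambda-A:\mathcal D(A)\to\mathcal H$ is not a bijection with bounded inverse; $\sigma_p(A)$ is the set of $\lambda$ for which $\lambda-A$ is not injective; $\sigma_c(A)$ is the set of $\lambda\in\sigma(A)$ for which $\lambda-A$ is injective with dense range; $\sigma_r(A)$ is the set of $\lambda$ for which $\lambda-A$ is injective and its range is not dense. Then $$\sigma(L_0)=\{\lambda\in\mathbb C:\operatorname{Re}\lambda\le\tfrac12\},\quad \sigma_p(L_0)=\{\lambda\in\mathbb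 C:\operatorname{Re}\lambda<\tfrac12\},\quad \sigma_c(L_0)=\{\lambda\in\mathbb C:\operatorname{Re}\lambda=\tfrac12\},\quad \sigma_r(L_0)=\emptyset.$$ Moreover, for every $\lambda$ with $\operatorname{Re}\lambda<\tfrac12$, if $u_0(\rho,\lambda)=(1-\rho)^{1-\lambda}-(1+\rho)^{1-\lambda}$ for $0<\rho<1$, then the pair $\mathbf u=(u_1,u_2)$ with $u_1=\rho\,\partial_\rho u_0(\rho,\lambda)+(\lambda-1)u_0(\rho,\lambda)$ and $u_2=\partial_\rho u_0(\rho,\lambda)$ is a nonzero element of $\mathcal D(L_0)$ and satisfies $L_0\mathbf u=\lambda\mathbf u$. -/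

import Mathlib

open MeasureTheory Set

noncomputable section

namespace FreeWave

/-- Lebesgue measure on the interval `(0,1)`. -/
abbrev μ01 : Measure ℝ := volume.restrict (Ioo (0 : ℝ) 1)

/-- The Hilbert space `H = L²(0,1)²` of pairs of complex-valued functions, with its Hilbert norm
`‖(u₁, u₂)‖² = ‖u₁‖² + ‖u₂‖²`. -/
abbrev H : Type := WithLp 2 (Lp ℂ 2 μ01 × Lp ℂ 2 μ01)

/-- The derivative on `[0,1]` (one-sided at the end points). -/
def D (f : ℝ → ℂ) (ρ : ℝ) : ℂ := derivWithin f (Icc 0 1) ρ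

/-- `f ∈ C¹[0,1]`. -/
def IsC1 (f : ℝ → ℂ) : Prop := ContDiffOn ℝ 1 f (Icc 0 1)

/-- First component of the expression `ℓ₀ (f, g) = (-ρ f' + g', f' - ρ g')`. -/
def ell₁ (f g : ℝ → ℂ) (ρ : ℝ) : ℂ := -(ρ : ℂ) * D f ρ + D g ρ

/-- Second component of the expression `ℓ₀ (f, g) = (-ρ f' + g', f' - ρ g')`. -/
def ell₂ (f g : ℝ → ℂ) (ρ : ℝ) : ℂ := D f ρ - (ρ : ℂ) * D g ρ

/-- `(f, g)` represents the element `u` of `H`. -/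
def Represents (f g : ℝ → ℂ) (u : H) : Prop := u.fst =ᵐ[μ01] f ∧ u.snd =ᵐ[μ01] g

theorem IsC1.diff {f : ℝ → ℂ} (hf : IsC1 f) {ρ : ℝ} (hρ : ρ ∈ Icc (0 : ℝ) 1) :
    DifferentiableWithinAt ℝ f (Icc 0 1) ρ :=
  hf.differentiableOn one_ne_zero ρ hρ

theorem D_add {f g : ℝ → ℂ} (hf : IsC1 f) (hg : IsC1 g) {ρ : ℝ} (hρ : ρ ∈ Icc (0 : ℝ) 1) :
    D (f + g) ρ = D f ρ + D g ρ := by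
  unfold D
  exact derivWithin_add (hf.diff hρ) (hg.diff hρ)

theorem D_smul {f : ℝ → ℂ} (c : ℂ) (hf : IsC1 f) {ρ : ℝ} (hρ : ρ ∈ Icc (0 : ℝ) 1) :
    D (c • f) ρ = c * D f ρ := by
  unfold D
  exact derivWithin_const_smul c (hf.diff hρ)

theorem ae_mem : ∀ᵐ ρ ∂μ01, ρ ∈ Icc (0 : ℝ) 1 :=
  (ae_restrict_mem measurableSet_Ioo).mono fun _ h => Ioo_subset_Icc_self h

theorem Represents.add {f g f' g' : ℝ → ℂ} {u u' : H} (h : Represents f g u)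
    (h' : Represents f' g' u') : Represents (f + f') (g + g') (u + u') := by
  refine ⟨?_, ?_⟩
  · exact (Lp.coeFn_add u.fst u'.fst).trans (h.1.add h'.1)
  · exact (Lp.coeFn_add u.snd u'.snd).trans (h.2.add h'.2)

theorem Represents.smul {f g : ℝ → ℂ} {u : H} (c : ℂ) (h : Represents f g u) :
    Represents (c • f) (c • g) (c • u) := by
  refine ⟨?_, ?_⟩
  · exact (Lp.coeFn_smul c u.fst).trans (h.1.const_smul c)
  · exact (Lp.coeFn_smul c u.snd).trans (h.2.const_smul c)

theorem Represents.congr {f g f' g' : ℝ → ℂ} {u : H} (h : Represents f g u)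
    (hf : ∀ ρ ∈ Icc (0 : ℝ) 1, f ρ = f' ρ) (hg : ∀ ρ ∈ Icc (0 : ℝ) 1, g ρ = g' ρ) :
    Represents f' g' u :=
  ⟨h.1.trans (ae_mem.mono hf), h.2.trans (ae_mem.mono hg)⟩

/-- The graph of the operator `L̃₀ u = (-ρ u₁' + u₂', u₁' - ρ u₂')` in `H` with domain
`{u ∈ C¹[0,1]² : u₁(0) = 0}`. -/
def graph₀ : Submodule ℂ (H × H) where
  carrier := {p | ∃ f g : ℝ → ℂ, IsC1 f ∧ IsC1 g ∧ f 0 = 0 ∧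
    Represents f g p.1 ∧ Represents (ell₁ f g) (ell₂ f g) p.2}
  zero_mem' := by
    refine ⟨0, 0, contDiffOn_const, contDiffOn_const, rfl, ⟨Lp.coeFn_zero .., Lp.coeFn_zero ..⟩, ?_⟩
    have h : Represents 0 0 (0 : H) := ⟨Lp.coeFn_zero .., Lp.coeFn_zero ..⟩
    refine h.congr ?_ ?_ <;> intro ρ _ <;> simp [ell₁, ell₂, D]
  add_mem' := by
    rintro p q ⟨f, g, hf, hg, h0, h1, h2⟩ ⟨f', g', hf', hg', h0', h1', h2'⟩
    refine ⟨f + f', g + g', hf.add hf', hg.add hg', by simp [h0, h0'], h1.add h1',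
      (h2.add h2').congr ?_ ?_⟩ <;> intro ρ hρ <;>
      simp only [Pi.add_apply, ell₁, ell₂, D_add hf hf' hρ, D_add hg hg' hρ] <;> ring
  smul_mem' := by
    rintro c p ⟨f, g, hf, hg, h0, h1, h2⟩
    refine ⟨c • f, c • g, hf.const_smul c, hg.const_smul c, by simp [h0], h1.smul c,
      (h2.smul c).congr ?_ ?_⟩ <;> intro ρ hρ <;>
      simp only [Pi.smul_apply, smul_eq_mul, ell₁, ell₂, D_smul c hf hρ, D_smul c hg hρ] <;> ring

/-- `graph₀` is single-valued, so that it is the graph of an operator. -/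
theorem graph₀_singleValued (p : H × H) (hp : p ∈ graph₀) (h : p.1 = 0) : p.2 = 0 := by
  obtain ⟨f, g, hf, hg, -, h1, h2⟩ := hp
  have key : ∀ {k : ℝ → ℂ}, IsC1 k → k =ᵐ[μ01] 0 → ∀ ρ ∈ Icc (0 : ℝ) 1, D k ρ = 0 := by
    intro k hk hk0 ρ hρ
    have hz : EqOn k 0 (Icc 0 1) := by
      refine Measure.eqOn_Icc_of_ae_eq volume zero_ne_one ?_ hk.continuousOn continuousOn_const
      rwa [← restrict_Ioo_eq_restrict_Icc]
    unfold D
    rw [derivWithin_congr hz (hz hρ)]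
    exact congrFun (derivWithin_const (Icc (0 : ℝ) 1) (0 : ℂ)) ρ
  rw [h] at h1
  have hf0 := key hf (h1.1.symm.trans (Lp.coeFn_zero ..))
  have hg0 := key hg (h1.2.symm.trans (Lp.coeFn_zero ..))
  have h3 : Represents 0 0 p.2 := h2.congr
    (fun ρ hρ => by simp [ell₁, hf0 ρ hρ, hg0 ρ hρ]) (fun ρ hρ => by simp [ell₂, hf0 ρ hρ, hg0 ρ hρ])
  have e1 : p.2.fst = 0 := Lp.ext (h3.1.trans (Lp.coeFn_zero ..).symm)
  have e2 : p.2.snd = 0 := Lp.ext (h3.2.trans (Lp.coeFn_zero ..).symm)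
  exact (WithLp.ofLp_injective 2) (Prod.ext e1 e2)

/-- The operator `L̃₀ u = (-ρ u₁' + u₂', u₁' - ρ u₂')` with domain
`{u ∈ C¹[0,1]² : u₁(0) = 0}`, as an unbounded operator in `H`. -/
def L₀tilde : H →ₗ.[ℂ] H := graph₀.toLinearPMap

/-- The graph of `L̃₀` is the intended one. -/
theorem graph_L₀tilde : L₀tilde.graph = graph₀ :=
  Submodule.toLinearPMap_graph_eq _ graph₀_singleValued

theorem memLp_of_continuousOn {k : ℝ → ℂ} (hk : ContinuousOn k (Icc 0 1)) : MemLp k 2 μ01 := by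
  obtain ⟨C, hC⟩ := isCompact_Icc.exists_bound_of_continuousOn hk
  refine MemLp.of_bound ?_ C (ae_mem.mono hC)
  exact (hk.mono Ioo_subset_Icc_self).aestronglyMeasurable measurableSet_Ioo

/-- The domain of `L̃₀` is exactly `{u ∈ C¹[0,1]² : u₁(0) = 0}`. -/
theorem mem_domain_L₀tilde (u : H) :
    u ∈ L₀tilde.domain ↔ ∃ f g : ℝ → ℂ, IsC1 f ∧ IsC1 g ∧ f 0 = 0 ∧ Represents f g u := by
  constructor
  · rintro ⟨⟨_, v⟩, ⟨f, g, hf, hg, h0, h1, -⟩, rfl⟩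
    exact ⟨f, g, hf, hg, h0, h1⟩
  · rintro ⟨f, g, hf, hg, h0, h1⟩
    have hD : ∀ {k : ℝ → ℂ}, IsC1 k → ContinuousOn (D k) (Icc 0 1) := fun hk =>
      hk.continuousOn_derivWithin (uniqueDiffOn_Icc zero_lt_one) le_rfl
    have hid : ContinuousOn (fun ρ : ℝ => (ρ : ℂ)) (Icc 0 1) := Complex.continuous_ofReal.continuousOn
    have m1 := memLp_of_continuousOn ((hid.neg.mul (hD hf)).add (hD hg))
    have m2 := memLp_of_continuousOn ((hD hf).sub (hid.mul (hD hg)))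
    refine ⟨(u, WithLp.toLp 2 (m1.toLp _, m2.toLp _)), ⟨f, g, hf, hg, h0, h1, ?_, ?_⟩, rfl⟩
    · exact m1.coeFn_toLp
    · exact m2.coeFn_toLp

/-- The operator `L₀`, the closure of `L̃₀`. -/
def L₀ : H →ₗ.[ℂ] H := L₀tilde.closure

/-- The function `u₀(ρ, λ) = (1 - ρ)^(1 - λ) - (1 + ρ)^(1 - λ)`, with the principal powers of the
positive reals `1 - ρ` and `1 + ρ` for `0 < ρ < 1`. -/
def u₀ (l : ℂ) (ρ : ℝ) : ℂ :=
  ((1 - ρ : ℝ) : ℂ) ^ (1 - l) - ((1 + ρ : ℝ) : ℂ) ^ (1 - l)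

section Spectrum

variable {E : Type*} [NormedAddCommGroup E] [NormedSpace ℂ E]

/-- The operator `λ - A`, with domain that of `A`, as a linear map. -/
def shifted (A : E →ₗ.[ℂ] E) (l : ℂ) : A.domain →ₗ[ℂ] E := l • A.domain.subtype - A.toFun

/-- The resolvent set of an unbounded operator `A`: those `λ` for which `λ - A` is a bijection of
the domain of `A` onto the whole space with bounded inverse `R`. -/
def resolventSet (A : E →ₗ.[ℂ] E) : Set ℂ :=
  {l | Function.Bijective (shifted A l) ∧
    ∃ R : E →L[ℂ] E, ∀ x : A.domain, R (shifted A l x) = x}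

/-- The spectrum, the complement of the resolvent set. -/
def spectrum (A : E →ₗ.[ℂ] E) : Set ℂ := (resolventSet A)ᶜ

/-- The point spectrum: `λ - A` is not injective. -/
def pointSpectrum (A : E →ₗ.[ℂ] E) : Set ℂ :=
  {l | ¬ Function.Injective (shifted A l)}

/-- The continuous spectrum: `λ` is in the spectrum, and `λ - A` is injective with dense range. -/
def continuousSpectrum (A : E →ₗ.[ℂ] E) : Set ℂ :=
  {l | l ∈ spectrum A ∧ Function.Injective (shifted A l) ∧ DenseRange (shifted A l)}

/-- The residual spectrum: `λ - A` is injective and its range is not dense. -/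
def residualSpectrum (A : E →ₗ.[ℂ] E) : Set ℂ :=
  {l | Function.Injective (shifted A l) ∧ ¬ DenseRange (shifted A l)}

end Spectrum

end FreeWave

end

/-!
The idea behind the proof is the change of variables that glues the combinations `u₁ + u₂` and
`u₁ - u₂` into the single function `w(x) = u₁(x) + u₂(x)` for `0 < x < 1`,
`w(x) = u₂(-x) - u₁(-x)` for `-1 < x < 0`. The condition `u₁(0) = 0` says that `w` is continuous
at `0`, and the operator becomes `(1 - x) d/dx` on `L²(-1, 1)`, which has no boundary condition
at `-1` and degenerates at `1`. Its eigenfunctions `(1 - x) ^ (-λ)` are square integrable exactly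
for `Re λ < 1/2`. The arguments are carried out directly on pairs on `(0, 1)`.

* Dissipativity, `Re ⟪u, L₀ u⟫ ≤ ‖u‖² / 2` (`re_inner_le_of_mem_graph₀`), holds on the closure of
  the graph. Together with the density of polynomials it gives closability
  (`closure_singleValued`), and for `Re λ > 1/2` it bounds `λ - L₀` from below, so that the range
  of `λ - L₀` is closed (`isClosed_range_shifted`).
* A second energy identity, obtained by pairing `L₀ u` with `(1 + x) w`
  (`re_inner_weight_of_mem_graph₀`), still gives injectivity of `λ - L₀` for `Re λ = 1/2`
  (`injective_shifted`).
* On monomials `(λ - L₀) xⁿ = (λ + n) xⁿ - n xⁿ⁻¹`. Hence for `Re λ ≥ 1/2` the range contains all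
  polynomials and is dense (`denseRange_shifted`).
* For `Re λ < 1/2` the eigenfunctions lie in the domain of the closure as limits of
  `(1 + ε - x) ^ (-λ)` (`exists_eigenvector`). Eigenvalues approaching the line `Re λ = 1/2` show
  that no `λ` on it has a bounded resolvent (`notMem_resolventSet_of_re_eq`).
-/

noncomputable section

namespace FreeWave

open Filter Topology ComplexConjugate

/-! ### Integration on the unit interval -/

theorem continuousOn_ofReal : ContinuousOn (fun ρ : ℝ => (ρ : ℂ)) (Icc 0 1) :=
  Complex.continuous_ofReal.continuousOn

theorem integrable_of_continuousOn {k : ℝ → ℂ} (hk : ContinuousOn k (Icc 0 1)) :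
    Integrable k μ01 :=
  (memLp_of_continuousOn hk).integrable one_le_two

theorem integral_deriv_eq_sub {K K' : ℝ → ℂ} (hK : ContinuousOn K (Icc 0 1))
    (hK' : ContinuousOn K' (Icc 0 1)) (hd : ∀ ρ ∈ Ioo (0 : ℝ) 1, HasDerivAt K (K' ρ) ρ) :
    ∫ ρ, K' ρ ∂μ01 = K 1 - K 0 := by
  rw [← intervalIntegral.integral_eq_sub_of_hasDerivAt_of_le zero_le_one hK hd
    (hK'.intervalIntegrable_of_Icc zero_le_one), intervalIntegral.integral_of_le zero_le_one,
    integral_Ioc_eq_integral_Ioo]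

theorem IsC1.continuousOn_D {f : ℝ → ℂ} (hf : IsC1 f) : ContinuousOn (D f) (Icc 0 1) :=
  hf.continuousOn_derivWithin (uniqueDiffOn_Icc zero_lt_one) le_rfl

theorem IsC1.hasDerivAt {f : ℝ → ℂ} (hf : IsC1 f) {ρ : ℝ} (hρ : ρ ∈ Ioo (0 : ℝ) 1) :
    HasDerivAt f (D f ρ) ρ :=
  (hf.diff (Ioo_subset_Icc_self hρ)).hasDerivWithinAt.hasDerivAt (Icc_mem_nhds hρ.1 hρ.2)

theorem D_eq_of_hasDerivAt {f : ℝ → ℂ} {f' : ℂ} {ρ : ℝ} (hρ : ρ ∈ Icc (0 : ℝ) 1)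
    (h : HasDerivAt f f' ρ) : D f ρ = f' :=
  h.hasDerivWithinAt.derivWithin (uniqueDiffOn_Icc zero_lt_one ρ hρ)

theorem IsC1.continuousOn_ell₁ {f g : ℝ → ℂ} (hf : IsC1 f) (hg : IsC1 g) :
    ContinuousOn (ell₁ f g) (Icc 0 1) :=
  (continuousOn_ofReal.neg.mul hf.continuousOn_D).add hg.continuousOn_D

theorem IsC1.continuousOn_ell₂ {f g : ℝ → ℂ} (hf : IsC1 f) (hg : IsC1 g) :
    ContinuousOn (ell₂ f g) (Icc 0 1) :=
  hf.continuousOn_D.sub (continuousOn_ofReal.mul hg.continuousOn_D)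

/-- An integrable function on `(0,1)` all of whose even moments vanish is zero: by Weierstrass'
theorem for `s ↦ g (√s)`, polynomials in `ρ²` approximate every continuous `g` uniformly. -/
theorem ae_eq_zero_of_even_moments {h : ℝ → ℂ} (hi : Integrable h μ01)
    (hm : ∀ n : ℕ, ∫ ρ, (ρ : ℂ) ^ (2 * n) * h ρ ∂μ01 = 0) : h =ᵐ[μ01] 0 := by
  have hpow : ∀ n : ℕ, Integrable (fun ρ : ℝ => (ρ : ℂ) ^ (2 * n) * h ρ) μ01 := by
    intro n
    refine hi.bdd_mul (c := 1) (by fun_prop) (ae_mem.mono fun ρ hρ => ?_)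
    rw [norm_pow, Complex.norm_real, Real.norm_of_nonneg hρ.1]
    exact pow_le_one₀ hρ.1 hρ.2
  have hpoly : ∀ p : Polynomial ℝ, Integrable (fun ρ : ℝ => (p.eval (ρ ^ 2)) • h ρ) μ01 ∧
      ∫ ρ, (p.eval (ρ ^ 2)) • h ρ ∂μ01 = 0 := by
    intro p
    have e : (fun ρ : ℝ => (p.eval (ρ ^ 2)) • h ρ) =
        fun ρ : ℝ => ∑ n ∈ p.support, (p.coeff n : ℂ) * ((ρ : ℂ) ^ (2 * n) * h ρ) := by
      funext ρ
      rw [Polynomial.eval_eq_sum, Polynomial.sum, Complex.real_smul, Complex.ofReal_sum,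
        Finset.sum_mul]
      refine Finset.sum_congr rfl fun n _ => ?_
      push_cast
      ring
    rw [e]
    refine ⟨integrable_finsetSum _ fun n _ => (hpow n).const_mul _, ?_⟩
    rw [integral_finsetSum _ fun n _ => (hpow n).const_mul _]
    exact Finset.sum_eq_zero fun n _ => by rw [integral_const_mul, hm n, mul_zero]
  have key : ∀ g : ℝ → ℝ, Continuous g → ∫ ρ, g ρ • h ρ ∂μ01 = 0 := by
    intro g hg
    have hle : ∀ ε > 0, ‖∫ ρ, g ρ • h ρ ∂μ01‖ ≤ ε * ∫ ρ, ‖h ρ‖ ∂μ01 := by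
      intro ε hε
      obtain ⟨p, hp⟩ := exists_polynomial_near_of_continuousOn 0 1 (fun s => g (√s))
        (hg.comp Real.continuous_sqrt).continuousOn ε hε
      have hb : ∀ᵐ ρ ∂μ01, ‖(g ρ - p.eval (ρ ^ 2)) • h ρ‖ ≤ ε * ‖h ρ‖ := by
        refine ae_mem.mono fun ρ hρ => ?_
        have := hp (ρ ^ 2) ⟨by positivity, pow_le_one₀ hρ.1 hρ.2⟩
        simp only [Real.sqrt_sq hρ.1] at this
        rw [norm_smul, Real.norm_eq_abs, abs_sub_comm]
        gcongr
      have hint : Integrable (fun ρ => (g ρ - p.eval (ρ ^ 2)) • h ρ) μ01 := by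
        refine (hi.norm.const_mul ε).mono' ?_ hb
        have hc : Continuous fun ρ : ℝ => g ρ - p.eval (ρ ^ 2) :=
          hg.sub (p.continuous.comp (continuous_pow 2))
        exact hc.aestronglyMeasurable.smul hi.1
      have e : ∫ ρ, g ρ • h ρ ∂μ01 = ∫ ρ, (g ρ - p.eval (ρ ^ 2)) • h ρ ∂μ01 := by
        rw [← add_zero (∫ ρ, (g ρ - p.eval (ρ ^ 2)) • h ρ ∂μ01), ← (hpoly p).2,
          ← integral_add hint (hpoly p).1]
        simp_rw [← add_smul, sub_add_cancel]
      rw [e, ← integral_const_mul]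
      exact norm_integral_le_of_norm_le (hi.norm.const_mul ε) hb
    have ht : Tendsto (fun ε : ℝ => ε * ∫ ρ, ‖h ρ‖ ∂μ01) (𝓝[>] 0) (𝓝 0) := by
      have : Tendsto (fun ε : ℝ => ε * ∫ ρ, ‖h ρ‖ ∂μ01) (𝓝 0) (𝓝 (0 * ∫ ρ, ‖h ρ‖ ∂μ01)) :=
        (continuous_id.mul continuous_const).tendsto 0
      rw [zero_mul] at this
      exact this.mono_left nhdsWithin_le_nhds
    exact norm_le_zero_iff.1 (ge_of_tendsto ht (eventually_mem_nhdsWithin.mono hle))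
  have := isOpen_univ.ae_eq_zero_of_integral_contDiff_smul_eq_zero (U := univ)
    (hi.locallyIntegrable.locallyIntegrableOn univ) (fun g hg _ _ => key g hg.continuous)
  exact this.mono fun ρ hρ => hρ (mem_univ ρ)

/-! ### Elements of `H` and their representatives -/

theorem inner_eq_integral {a b : Lp ℂ 2 μ01} {f g : ℝ → ℂ} (ha : a =ᵐ[μ01] f)
    (hb : b =ᵐ[μ01] g) : inner ℂ a b = ∫ ρ, conj (f ρ) * g ρ ∂μ01 := by
  rw [L2.inner_def]
  refine integral_congr_ae ?_
  filter_upwards [ha, hb] with ρ h1 h2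
  rw [h1, h2, RCLike.inner_apply, mul_comm]

theorem norm_sq_eq_integral {a : Lp ℂ 2 μ01} {f : ℝ → ℂ} (ha : a =ᵐ[μ01] f) :
    ‖a‖ ^ 2 = ∫ ρ, ‖f ρ‖ ^ 2 ∂μ01 := by
  have h := inner_eq_integral ha ha
  rw [inner_self_eq_norm_sq_to_K] at h
  have e : ∀ ρ, conj (f ρ) * f ρ = ((‖f ρ‖ ^ 2 : ℝ) : ℂ) := fun ρ => by
    rw [Complex.conj_mul']
    push_cast
    rfl
  simp_rw [e] at h
  exact_mod_cast h.trans integral_ofReal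

/-- The element of `H` with the given square integrable components. -/
def pair {f g : ℝ → ℂ} (hf : MemLp f 2 μ01) (hg : MemLp g 2 μ01) : H :=
  WithLp.toLp 2 (hf.toLp f, hg.toLp g)

theorem represents_pair {f g : ℝ → ℂ} (hf : MemLp f 2 μ01) (hg : MemLp g 2 μ01) :
    Represents f g (pair hf hg) :=
  ⟨hf.coeFn_toLp, hg.coeFn_toLp⟩

theorem Represents.unique {f g : ℝ → ℂ} {u v : H} (hu : Represents f g u)
    (hv : Represents f g v) : u = v :=
  WithLp.ofLp_injective 2
    (Prod.ext (Lp.ext (hu.1.trans hv.1.symm)) (Lp.ext (hu.2.trans hv.2.symm)))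

theorem Represents.inner_eq {f g f' g' : ℝ → ℂ} {u u' : H} (h : Represents f g u)
    (h' : Represents f' g' u') (hf : ContinuousOn f (Icc 0 1)) (hg : ContinuousOn g (Icc 0 1))
    (hf' : ContinuousOn f' (Icc 0 1)) (hg' : ContinuousOn g' (Icc 0 1)) :
    inner ℂ u u' = ∫ ρ, (conj (f ρ) * f' ρ + conj (g ρ) * g' ρ) ∂μ01 := by
  have k1 : ContinuousOn (fun ρ => conj (f ρ) * f' ρ) (Icc 0 1) := hf.star.mul hf'
  have k2 : ContinuousOn (fun ρ => conj (g ρ) * g' ρ) (Icc 0 1) := hg.star.mul hg'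
  rw [integral_add (integrable_of_continuousOn k1) (integrable_of_continuousOn k2),
    WithLp.prod_inner_apply, ← inner_eq_integral h.1 h'.1, ← inner_eq_integral h.2 h'.2]
  rfl

/-! ### Multiplication by the independent variable -/

theorem memLp_top_ofReal : MemLp (fun ρ : ℝ => (ρ : ℂ)) ⊤ μ01 := by
  refine memLp_top_of_bound (by fun_prop) 1 (ae_mem.mono fun ρ hρ => ?_)
  rw [Complex.norm_real, Real.norm_of_nonneg hρ.1]
  exact hρ.2

/-- Multiplication by `ρ` as a bounded operator on `L²(0,1)`. -/
def mulX : Lp ℂ 2 μ01 →L[ℂ] Lp ℂ 2 μ01 :=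
  (ContinuousLinearMap.mul ℂ ℂ).holderL μ01 ⊤ 2 2 (memLp_top_ofReal.toLp _)

theorem coeFn_mulX {a : Lp ℂ 2 μ01} {f : ℝ → ℂ} (ha : a =ᵐ[μ01] f) :
    mulX a =ᵐ[μ01] fun ρ => (ρ : ℂ) * f ρ := by
  have h := (ContinuousLinearMap.mul ℂ ℂ).coeFn_holder (r := 2) (memLp_top_ofReal.toLp _) a
  filter_upwards [h, memLp_top_ofReal.coeFn_toLp, ha] with ρ h1 h2 h3
  rw [h2, h3] at h1
  exact h1

theorem inner_mulX_left (a b : Lp ℂ 2 μ01) : inner ℂ (mulX a) b = inner ℂ a (mulX b) := by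
  rw [inner_eq_integral (coeFn_mulX (ae_eq_refl a)) (ae_eq_refl b),
    inner_eq_integral (ae_eq_refl a) (coeFn_mulX (ae_eq_refl b))]
  congr 1
  funext ρ
  rw [map_mul, Complex.conj_ofReal]
  ring

theorem norm_mulX_le (a : Lp ℂ 2 μ01) : ‖mulX a‖ ≤ ‖a‖ := by
  refine Lp.norm_le_norm_of_ae_le ?_
  filter_upwards [coeFn_mulX (ae_eq_refl a), ae_mem] with ρ h1 h2
  rw [h1, norm_mul, Complex.norm_real, Real.norm_of_nonneg h2.1]
  exact mul_le_of_le_one_left (norm_nonneg _) h2.2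

theorem eq_zero_of_mulX_mulX_eq {a : Lp ℂ 2 μ01} (h : mulX (mulX a) = a) : a = 0 := by
  refine Lp.ext (EventuallyEq.trans ?_ (Lp.coeFn_zero ..).symm)
  have h1 := coeFn_mulX (coeFn_mulX (ae_eq_refl a))
  rw [h] at h1
  filter_upwards [h1, ae_restrict_mem measurableSet_Ioo] with ρ h2 hρ
  have h3 : (1 - (ρ : ℂ) * ρ) * a ρ = 0 := by linear_combination h2
  refine (mul_eq_zero.1 h3).resolve_left ?_
  have h4 : (1 - ρ * ρ : ℝ) ≠ 0 := by nlinarith [hρ.1, hρ.2]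
  exact_mod_cast h4

/-- The operator `(u₁, u₂) ↦ (u₁ + ρ u₂, ρ u₁ + u₂)`. It multiplies `u₁ + u₂` by `1 + ρ` and
`u₁ - u₂` by `1 - ρ`. -/
def weight (u : H) : H := WithLp.toLp 2 (u.fst + mulX u.snd, mulX u.fst + u.snd)

theorem continuous_weight : Continuous weight := by
  unfold weight
  fun_prop

theorem Represents.weight {f g : ℝ → ℂ} {u : H} (h : Represents f g u) :
    Represents (fun ρ => f ρ + ρ * g ρ) (fun ρ => ρ * f ρ + g ρ) (weight u) := by
  refine ⟨?_, ?_⟩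
  · exact (Lp.coeFn_add u.fst (mulX u.snd)).trans (h.1.add (coeFn_mulX h.2))
  · exact (Lp.coeFn_add (mulX u.fst) u.snd).trans ((coeFn_mulX h.1).add h.2)

/-! ### Energy identities -/

/-- The operator `L₀ - 1/2` is dissipative: in
`Re ⟪u, L₀ u⟫ = ‖u‖² / 2 - |u₁(1) - u₂(1)|² / 2`
the boundary term at `0` vanishes since `u₁(0) = 0`. -/
theorem re_inner_le_of_mem_graph₀ {u v : H} (hp : (u, v) ∈ graph₀) :
    (inner ℂ u v).re ≤ 1 / 2 * ‖u‖ ^ 2 := by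
  obtain ⟨f, g, hf, hg, h0, hu : Represents f g u,
    hv : Represents (ell₁ f g) (ell₂ f g) v⟩ := hp
  have cf := hf.continuousOn
  have cg := hg.continuousOn
  have c1 := hf.continuousOn_ell₁ hg
  have c2 := hf.continuousOn_ell₂ hg
  have i1 := hu.inner_eq hv cf cg c1 c2
  have i2 := hv.inner_eq hu c1 c2 cf cg
  have i3 := hu.inner_eq hu cf cg cf cg
  have k1 : ContinuousOn (fun ρ => conj (f ρ) * ell₁ f g ρ + conj (g ρ) * ell₂ f g ρ)
    (Icc 0 1) := (cf.star.mul c1).add (cg.star.mul c2)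
  have k2 : ContinuousOn (fun ρ => conj (ell₁ f g ρ) * f ρ + conj (ell₂ f g ρ) * g ρ)
    (Icc 0 1) := (c1.star.mul cf).add (c2.star.mul cg)
  have k3 : ContinuousOn (fun ρ => conj (f ρ) * f ρ + conj (g ρ) * g ρ) (Icc 0 1) :=
    (cf.star.mul cf).add (cg.star.mul cg)
  have k12 := k1.fun_add k2
  have ftc := integral_deriv_eq_sub
    (K := fun ρ => -ρ * (conj (f ρ) * f ρ + conj (g ρ) * g ρ)
      + (conj (f ρ) * g ρ + conj (g ρ) * f ρ))
    (K' := fun ρ => ((conj (f ρ) * ell₁ f g ρ + conj (g ρ) * ell₂ f g ρ)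
      + (conj (ell₁ f g ρ) * f ρ + conj (ell₂ f g ρ) * g ρ))
      - (conj (f ρ) * f ρ + conj (g ρ) * g ρ))
    ((continuousOn_ofReal.neg.mul k3).add ((cf.star.mul cg).add (cg.star.mul cf)))
    ((k1.add k2).sub k3) (by
      intro ρ hρ
      have df := hf.hasDerivAt hρ
      have dg := hg.hasDerivAt hρ
      have dX : HasDerivAt (fun ρ : ℝ => -(ρ : ℂ)) (-1) ρ := by
        simpa using (hasDerivAt_id ρ).ofReal_comp.fun_neg
      refine ((dX.mul ((df.star.mul df).add (dg.star.mul dg))).add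
        ((df.star.mul dg).add (dg.star.mul df))).congr_deriv ?_
      simp only [Pi.mul_apply, Pi.add_apply, ell₁, ell₂, map_add, map_sub, map_mul, map_neg,
        Complex.conj_ofReal, Complex.star_def]
      ring)
  rw [integral_sub (integrable_of_continuousOn k12) (integrable_of_continuousOn k3),
    integral_add (integrable_of_continuousOn k1) (integrable_of_continuousOn k2), ← i1, ← i2,
    ← i3, ← inner_conj_symm v u, inner_self_eq_norm_sq_to_K] at ftc
  have hre := congrArg Complex.re ftc
  simp only [h0, Complex.add_re, Complex.sub_re, Complex.mul_re, Complex.conj_re,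
    Complex.conj_im, Complex.ofReal_one, Complex.one_re, Complex.neg_re, Complex.neg_im,
    Complex.one_im, Complex.add_im, Complex.mul_im, map_zero, Complex.zero_re,
    Complex.zero_im, Complex.ofReal_zero] at hre
  have hn : (((‖u‖ : ℝ) : ℂ) ^ 2).re = ‖u‖ ^ 2 := by norm_cast
  have hn' := hre.symm.trans (congrArg (fun t => (inner ℂ u v).re + (inner ℂ u v).re - t) hn)
  nlinarith [sq_nonneg ((f 1).re - (g 1).re), sq_nonneg ((f 1).im - (g 1).im)]

/-- The real part of the weighted pairing is the integral of `(1 - ρ²) (Re (conj u₁ * u₂))'`. The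
boundary terms vanish at both end points, since `1 - ρ² = 0` at `1` and `u₁ = 0` at `0`. -/
theorem re_inner_weight_of_mem_graph₀ {u v : H} (hp : (u, v) ∈ graph₀) :
    (inner ℂ (weight u) v).re = 2 * (inner ℂ (mulX u.fst) u.snd).re := by
  obtain ⟨f, g, hf, hg, h0, hu : Represents f g u,
    hv : Represents (ell₁ f g) (ell₂ f g) v⟩ := hp
  have cf := hf.continuousOn
  have cg := hg.continuousOn
  have cX := continuousOn_ofReal
  have c1 := hf.continuousOn_ell₁ hg
  have c2 := hf.continuousOn_ell₂ hg
  have w1 : ContinuousOn (fun ρ : ℝ => f ρ + ρ * g ρ) (Icc 0 1) := cf.add (cX.mul cg)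
  have w2 : ContinuousOn (fun ρ : ℝ => ρ * f ρ + g ρ) (Icc 0 1) := (cX.mul cf).add cg
  have i1 := hu.weight.inner_eq hv w1 w2 c1 c2
  have i2 := hv.inner_eq hu.weight c1 c2 w1 w2
  have i3 := inner_eq_integral (coeFn_mulX hu.1) hu.2
  have i4 := inner_eq_integral hu.2 (coeFn_mulX hu.1)
  have k1 : ContinuousOn (fun ρ => conj (f ρ + ρ * g ρ) * ell₁ f g ρ
    + conj (ρ * f ρ + g ρ) * ell₂ f g ρ) (Icc 0 1) := (w1.star.mul c1).add (w2.star.mul c2)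
  have k2 : ContinuousOn (fun ρ => conj (ell₁ f g ρ) * (f ρ + ρ * g ρ)
    + conj (ell₂ f g ρ) * (ρ * f ρ + g ρ)) (Icc 0 1) := (c1.star.mul w1).add (c2.star.mul w2)
  have k12 := k1.fun_add k2
  have k3 : ContinuousOn (fun ρ : ℝ => conj (ρ * f ρ) * g ρ) (Icc 0 1) := (cX.mul cf).star.mul cg
  have k4 : ContinuousOn (fun ρ : ℝ => conj (g ρ) * (ρ * f ρ)) (Icc 0 1) := cg.star.mul (cX.mul cf)
  have k34 : ContinuousOn (fun ρ : ℝ =>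
    (2 : ℂ) • (conj (ρ * f ρ) * g ρ + conj (g ρ) * (ρ * f ρ))) (Icc 0 1) :=
    (k3.add k4).const_smul (2 : ℂ)
  have ftc := integral_deriv_eq_sub
    (K := fun ρ => (1 - ρ * ρ) * (conj (f ρ) * g ρ + conj (g ρ) * f ρ))
    (K' := fun ρ => ((conj (f ρ + ρ * g ρ) * ell₁ f g ρ + conj (ρ * f ρ + g ρ) * ell₂ f g ρ)
      + (conj (ell₁ f g ρ) * (f ρ + ρ * g ρ) + conj (ell₂ f g ρ) * (ρ * f ρ + g ρ)))
      - (2 : ℂ) • (conj (ρ * f ρ) * g ρ + conj (g ρ) * (ρ * f ρ)))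
    ((continuousOn_const.sub (cX.mul cX)).mul ((cf.star.mul cg).add (cg.star.mul cf)))
    ((k1.add k2).sub k34) (by
      intro ρ hρ
      have df := hf.hasDerivAt hρ
      have dg := hg.hasDerivAt hρ
      have dX : HasDerivAt (fun ρ : ℝ => (ρ : ℂ)) 1 ρ := by
        simpa using (hasDerivAt_id ρ).ofReal_comp
      refine (((hasDerivAt_const ρ (1 : ℂ)).sub (dX.mul dX)).mul
        ((df.star.mul dg).add (dg.star.mul df))).congr_deriv ?_
      simp only [Pi.mul_apply, Pi.add_apply, Pi.sub_apply, ell₁, ell₂, map_add, map_sub, map_mul,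
        map_neg, Complex.conj_ofReal, Complex.star_def, smul_eq_mul]
      ring)
  rw [integral_sub (integrable_of_continuousOn k12) (integrable_of_continuousOn k34),
    integral_add (integrable_of_continuousOn k1) (integrable_of_continuousOn k2),
    integral_smul, integral_add (integrable_of_continuousOn k3) (integrable_of_continuousOn k4),
    ← i1, ← i2, ← i3, ← i4, ← inner_conj_symm v, ← inner_conj_symm u.snd] at ftc
  have hre := congrArg Complex.re ftc
  simp only [h0, Complex.ofReal_one, Complex.ofReal_zero, mul_one, sub_self, zero_mul, map_zero,
    mul_zero, add_zero, Complex.add_re, Complex.sub_re, Complex.conj_re, smul_eq_mul,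
    Complex.re_ofNat, Complex.im_ofNat, Complex.mul_re, sub_zero, Complex.zero_re] at hre
  linarith

/-! ### Polynomial elements of the domain -/

/-- First component of the `n`-th basic polynomial pair: `ρⁿ` for odd `n`, zero for even `n`. -/
def oddPow (n : ℕ) (ρ : ℝ) : ℂ := if Even n then 0 else (ρ : ℂ) ^ n

/-- Second component of the `n`-th basic polynomial pair: `ρⁿ` for even `n`, zero for odd `n`. -/
def evenPow (n : ℕ) (ρ : ℝ) : ℂ := if Even n then (ρ : ℂ) ^ n else 0

theorem contDiff_ofReal_pow (n : ℕ) : ContDiff ℝ 1 fun ρ : ℝ => (ρ : ℂ) ^ n :=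
  Complex.ofRealCLM.contDiff.pow n

theorem oddPow_of_even {n : ℕ} (h : Even n) : oddPow n = fun _ => 0 :=
  funext fun _ => if_pos h

theorem oddPow_of_not_even {n : ℕ} (h : ¬ Even n) : oddPow n = fun ρ : ℝ => (ρ : ℂ) ^ n :=
  funext fun _ => if_neg h

theorem evenPow_of_even {n : ℕ} (h : Even n) : evenPow n = fun ρ : ℝ => (ρ : ℂ) ^ n :=
  funext fun _ => if_pos h

theorem evenPow_of_not_even {n : ℕ} (h : ¬ Even n) : evenPow n = fun _ => 0 :=
  funext fun _ => if_neg h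

theorem isC1_oddPow (n : ℕ) : IsC1 (oddPow n) := by
  by_cases h : Even n
  · rw [oddPow_of_even h]
    exact contDiffOn_const
  · rw [oddPow_of_not_even h]
    exact (contDiff_ofReal_pow n).contDiffOn

theorem isC1_evenPow (n : ℕ) : IsC1 (evenPow n) := by
  by_cases h : Even n
  · rw [evenPow_of_even h]
    exact (contDiff_ofReal_pow n).contDiffOn
  · rw [evenPow_of_not_even h]
    exact contDiffOn_const

theorem oddPow_zero_right (n : ℕ) : oddPow n 0 = 0 := by
  rw [oddPow]
  split_ifs with h
  · rfl
  · have : n ≠ 0 := by rintro rfl; exact h Even.zero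
    simp [this]

/-- The polynomial pair `(oddPow n, evenPow n)` as an element of `H`. It corresponds to the
monomial `xⁿ` on `(-1, 1)`. -/
def powPair (n : ℕ) : H :=
  pair (memLp_of_continuousOn (isC1_oddPow n).continuousOn)
    (memLp_of_continuousOn (isC1_evenPow n).continuousOn)

theorem represents_powPair (n : ℕ) : Represents (oddPow n) (evenPow n) (powPair n) :=
  represents_pair _ _

theorem hasDerivAt_ofReal_pow (n : ℕ) (ρ : ℝ) :
    HasDerivAt (fun ρ : ℝ => (ρ : ℂ) ^ n) (n * (ρ : ℂ) ^ (n - 1)) ρ := by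
  simpa using (hasDerivAt_id ρ).ofReal_comp.fun_pow n

theorem D_oddPow {n : ℕ} {ρ : ℝ} (hρ : ρ ∈ Icc (0 : ℝ) 1) :
    D (oddPow n) ρ = if Even n then 0 else n * (ρ : ℂ) ^ (n - 1) := by
  refine D_eq_of_hasDerivAt hρ ?_
  split_ifs with h
  · rw [oddPow_of_even h]
    exact hasDerivAt_const ρ 0
  · rw [oddPow_of_not_even h]
    exact hasDerivAt_ofReal_pow n ρ

theorem D_evenPow {n : ℕ} {ρ : ℝ} (hρ : ρ ∈ Icc (0 : ℝ) 1) :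
    D (evenPow n) ρ = if Even n then n * (ρ : ℂ) ^ (n - 1) else 0 := by
  refine D_eq_of_hasDerivAt hρ ?_
  split_ifs with h
  · rw [evenPow_of_even h]
    exact hasDerivAt_ofReal_pow n ρ
  · rw [evenPow_of_not_even h]
    exact hasDerivAt_const ρ 0

/-- On monomials `L̃₀` acts as `(1 - x) d/dx`. For `n = 0` the coefficient of the spurious
`powPair (0 - 1)` is zero. -/
theorem powPair_mem_graph₀ (n : ℕ) :
    (powPair n, -(n : ℂ) • powPair n + (n : ℂ) • powPair (n - 1)) ∈ graph₀ := by
  have h := represents_powPair n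
  refine ⟨_, _, isC1_oddPow n, isC1_evenPow n, oddPow_zero_right n, h,
    ((h.smul _).add ((represents_powPair (n - 1)).smul _)).congr ?_ ?_⟩ <;> intro ρ hρ <;>
    simp only [ell₁, ell₂, D_oddPow hρ, D_evenPow hρ, oddPow, evenPow, Pi.add_apply, Pi.smul_apply,
      smul_eq_mul] <;>
    rcases n with _ | n
  · simp
  · by_cases hn : Even n <;> simp [Nat.even_add_one, hn]
    ring
  · simp
  · by_cases hn : Even n <;> simp [Nat.even_add_one, hn]
    ring

/-- The polynomial pairs span a dense subspace. -/
theorem topologicalClosure_eq_top {S : Submodule ℂ H} (hS : ∀ n, powPair n ∈ S) :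
    S.topologicalClosure = ⊤ := by
  rw [Submodule.topologicalClosure_eq_top_iff, Submodule.eq_bot_iff]
  intro u hu
  have hu' : ∀ n, inner ℂ (powPair n) u = 0 := fun n =>
    (Submodule.mem_orthogonal S u).1 hu _ (hS n)
  simp only [WithLp.prod_inner_apply] at hu'
  have i1 : Integrable u.fst μ01 := (Lp.memLp u.fst).integrable one_le_two
  have i2 : Integrable u.snd μ01 := (Lp.memLp u.snd).integrable one_le_two
  have m1 : ∀ n : ℕ, ∫ ρ, (ρ : ℂ) ^ (2 * n) * ((ρ : ℂ) * u.fst ρ) ∂μ01 = 0 := by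
    intro n
    have hn : ¬ Even (2 * n + 1) := by simp
    have h := hu' (2 * n + 1)
    have e1 := inner_eq_integral (represents_powPair (2 * n + 1)).1 (ae_eq_refl u.fst)
    have e2 := inner_eq_integral (represents_powPair (2 * n + 1)).2 (ae_eq_refl u.snd)
    simp only [oddPow, evenPow, hn, if_false, map_zero, zero_mul, integral_zero, map_pow,
      Complex.conj_ofReal] at e1 e2
    simp_rw [← mul_assoc, ← pow_succ]
    rw [← e1, ← h]
    simpa using e2
  have m2 : ∀ n : ℕ, ∫ ρ, (ρ : ℂ) ^ (2 * n) * u.snd ρ ∂μ01 = 0 := by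
    intro n
    have hn : Even (2 * n) := by simp
    have h := hu' (2 * n)
    have e1 := inner_eq_integral (represents_powPair (2 * n)).1 (ae_eq_refl u.fst)
    have e2 := inner_eq_integral (represents_powPair (2 * n)).2 (ae_eq_refl u.snd)
    simp only [oddPow, evenPow, hn, if_true, map_zero, zero_mul, integral_zero, map_pow,
      Complex.conj_ofReal] at e1 e2
    rw [← e2, ← h]
    simpa using e1
  have i1' : Integrable (fun ρ : ℝ => (ρ : ℂ) * u.fst ρ) μ01 :=
    ((Lp.memLp (mulX u.fst)).integrable one_le_two).congr (coeFn_mulX (ae_eq_refl _))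
  have z1 := ae_eq_zero_of_even_moments i1' m1
  have z2 := ae_eq_zero_of_even_moments i2 m2
  have z1' : u.fst =ᵐ[μ01] 0 := by
    filter_upwards [z1, ae_restrict_mem measurableSet_Ioo] with ρ h hρ
    exact (mul_eq_zero.1 h).resolve_left (by exact_mod_cast hρ.1.ne')
  exact Represents.unique ⟨z1', z2⟩ ⟨Lp.coeFn_zero .., Lp.coeFn_zero ..⟩

/-! ### The closure of the graph -/

theorem forall_mem_topologicalClosure {S : Submodule ℂ (H × H)} {P : H × H → Prop}
    (hP : IsClosed {p | P p}) (h : ∀ p ∈ S, P p) : ∀ p ∈ S.topologicalClosure, P p :=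
  fun _ hp => closure_minimal h hP hp

theorem re_inner_le_of_mem_closure {p : H × H} (hp : p ∈ graph₀.topologicalClosure) :
    (inner ℂ p.1 p.2).re ≤ 1 / 2 * ‖p.1‖ ^ 2 := by
  refine forall_mem_topologicalClosure (P := fun p => (inner ℂ p.1 p.2).re ≤ 1 / 2 * ‖p.1‖ ^ 2) ?_
    (fun _ h => re_inner_le_of_mem_graph₀ h) p hp
  exact isClosed_le (Complex.continuous_re.comp (continuous_fst.inner continuous_snd))
    (by fun_prop)

theorem re_inner_weight_of_mem_closure {p : H × H} (hp : p ∈ graph₀.topologicalClosure) :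
    (inner ℂ (weight p.1) p.2).re = 2 * (inner ℂ (mulX p.1.fst) p.1.snd).re := by
  refine forall_mem_topologicalClosure (P := fun p =>
    (inner ℂ (weight p.1) p.2).re = 2 * (inner ℂ (mulX p.1.fst) p.1.snd).re) ?_
    (fun _ h => re_inner_weight_of_mem_graph₀ h) p hp
  refine isClosed_eq (Complex.continuous_re.comp
    ((continuous_weight.comp continuous_fst).inner continuous_snd))
    (continuous_const.mul (Complex.continuous_re.comp (Continuous.inner ?_ ?_))) <;> fun_prop

/-- The closure of the graph is single-valued: dissipativity at `(u, w + s v)`, for `(u, w)` in the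
graph and all scalars `s`, forces `v` to be orthogonal to the dense domain. -/
theorem closure_singleValued (p : H × H) (hp : p ∈ graph₀.topologicalClosure) (h : p.1 = 0) :
    p.2 = 0 := by
  obtain ⟨_, v⟩ := p
  obtain rfl : _ = 0 := h
  have key : ∀ n, inner ℂ (powPair n) v = 0 := by
    intro n
    set u := powPair n
    set w := -(n : ℂ) • powPair n + (n : ℂ) • powPair (n - 1) with hw
    have hs : ∀ s : ℂ, (inner ℂ u w).re + (s * inner ℂ u v).re ≤ 1 / 2 * ‖u‖ ^ 2 := by
      intro s
      have hm := Submodule.add_mem _ (graph₀.le_topologicalClosure (powPair_mem_graph₀ n))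
        (Submodule.smul_mem _ s hp)
      have h := re_inner_le_of_mem_closure hm
      rw [Prod.mk_add_mk, Prod.smul_mk] at h
      rwa [smul_zero, add_zero, inner_add_right, inner_smul_right, Complex.add_re] at h
    by_contra hne
    -- this scalar makes the left-hand side exceed the right-hand side by one
    have := hs (((1 / 2 * ‖u‖ ^ 2 - (inner ℂ u w).re + 1 : ℝ) : ℂ) / inner ℂ u v)
    rw [div_mul_cancel₀ _ hne, Complex.ofReal_re] at this
    linarith
  have hv : v ∈ (Submodule.span ℂ (range powPair))ᗮ := by
    rw [Submodule.mem_orthogonal]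
    intro x hx
    induction hx using Submodule.span_induction with
    | mem x hx => obtain ⟨n, rfl⟩ := hx; exact key n
    | zero => exact inner_zero_left _
    | add x y _ _ hx hy => rw [inner_add_left, hx, hy, add_zero]
    | smul c x _ hx => rw [inner_smul_left, hx, mul_zero]
  rw [Submodule.topologicalClosure_eq_top_iff.1 (topologicalClosure_eq_top
    fun n => Submodule.subset_span (mem_range_self n))] at hv
  exact (Submodule.mem_bot ℂ).1 hv

theorem isClosable_L₀tilde : L₀tilde.IsClosable := by
  refine ⟨graph₀.topologicalClosure.toLinearPMap, ?_⟩
  rw [Submodule.toLinearPMap_graph_eq _ closure_singleValued, graph_L₀tilde]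

theorem graph_L₀ : L₀.graph = graph₀.topologicalClosure := by
  rw [L₀, ← isClosable_L₀tilde.graph_closure_eq_closure_graph, graph_L₀tilde]

theorem mem_closure_graph₀ (x : L₀.domain) : ((x : H), L₀ x) ∈ graph₀.topologicalClosure :=
  graph_L₀ ▸ L₀.mem_graph x

theorem exists_of_mem_closure {u v : H} (h : (u, v) ∈ graph₀.topologicalClosure) :
    ∃ x : L₀.domain, (x : H) = u ∧ L₀ x = v :=
  L₀.mem_graph_iff.1 (graph_L₀ ▸ h)

theorem shifted_apply (l : ℂ) (x : L₀.domain) : shifted L₀ l x = l • (x : H) - L₀ x := rfl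

/-! ### The half-plane `Re λ ≥ 1/2` -/

/-- If `L₀ u = λ u`, the weighted identity reads `Re λ (N + 2 c) = 2 c` with `N = ‖u‖²` and
`c = Re ⟪ρ u₁, u₂⟫`. As `-N ≤ 2 c ≤ N`, the assumption on `λ` forces `2 c = N`, which means
`ρ u₁ = u₂` and `ρ u₂ = u₁`. -/
theorem injective_shifted {l : ℂ} (hl : 1 / 2 ≤ l.re) : Function.Injective (shifted L₀ l) := by
  refine (injective_iff_map_eq_zero _).2 fun x hx => Subtype.ext ?_
  rw [shifted_apply, sub_eq_zero] at hx
  have h := re_inner_weight_of_mem_closure (mem_closure_graph₀ x)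
  rw [← hx] at h
  obtain ⟨u, hu⟩ := x
  change u = 0
  simp only [inner_smul_right] at h
  set c := (inner ℂ (mulX u.fst) u.snd).re
  have e1 : inner ℂ (weight u) u =
      ((‖u.fst‖ ^ 2 + ‖u.snd‖ ^ 2 + 2 * c : ℝ) : ℂ) := by
    have hs : inner ℂ (mulX u.snd) u.fst + inner ℂ (mulX u.fst) u.snd = ((2 * c : ℝ) : ℂ) := by
      rw [inner_mulX_left, ← inner_conj_symm, add_comm, Complex.add_conj]
    rw [WithLp.prod_inner_apply]
    change inner ℂ (u.fst + mulX u.snd) u.fst + inner ℂ (mulX u.fst + u.snd) u.snd = _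
    rw [inner_add_left, inner_add_left, inner_self_eq_norm_sq_to_K, inner_self_eq_norm_sq_to_K,
      Complex.ofReal_add, ← hs]
    push_cast
    simp only [Complex.coe_algebraMap]
    ring
  rw [e1, Complex.re_mul_ofReal] at h
  have n1 := norm_sub_sq (𝕜 := ℂ) (mulX u.fst) u.snd
  have n2 := norm_sub_sq (𝕜 := ℂ) (mulX u.snd) u.fst
  have hc1 : RCLike.re (inner ℂ (mulX u.fst) u.snd) = c := rfl
  have hc2 : RCLike.re (inner ℂ (mulX u.snd) u.fst) = c := by
    rw [inner_mulX_left, ← inner_conj_symm, RCLike.conj_re, hc1]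
  rw [hc1] at n1
  rw [hc2] at n2
  have b1 := pow_le_pow_left₀ (norm_nonneg _) (norm_mulX_le u.fst) 2
  have b2 := pow_le_pow_left₀ (norm_nonneg _) (norm_mulX_le u.snd) 2
  have p1 := sq_nonneg ‖mulX u.fst - u.snd‖
  have p2 := sq_nonneg ‖mulX u.snd - u.fst‖
  have hN : 2 * c ≤ ‖u.fst‖ ^ 2 + ‖u.snd‖ ^ 2 := by linarith
  have hM : 0 ≤ ‖u.fst‖ ^ 2 + ‖u.snd‖ ^ 2 + 2 * c := by
    have := sq_nonneg ‖mulX u.fst + u.snd‖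
    rw [norm_add_sq (𝕜 := ℂ), hc1] at this
    linarith
  have hN' : ‖u.fst‖ ^ 2 + ‖u.snd‖ ^ 2 ≤ 2 * c := by nlinarith
  have q1 : mulX u.fst = u.snd := by
    refine sub_eq_zero.1 (norm_eq_zero.1 (pow_eq_zero_iff two_ne_zero |>.1 ?_))
    linarith
  have q2 : mulX u.snd = u.fst := by
    refine sub_eq_zero.1 (norm_eq_zero.1 (pow_eq_zero_iff two_ne_zero |>.1 ?_))
    linarith
  have z1 : u.fst = 0 := eq_zero_of_mulX_mulX_eq (by rw [q1, q2])
  have z2 : u.snd = 0 := by rw [← q1, z1, map_zero]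
  exact WithLp.ofLp_injective 2 (Prod.ext z1 z2)

/-- The range contains every `powPair n`, by induction from
`(λ - L₀) xⁿ = (λ + n) xⁿ - n xⁿ⁻¹`. -/
theorem denseRange_shifted {l : ℂ} (hl : 1 / 2 ≤ l.re) : DenseRange (shifted L₀ l) := by
  have hmem : ∀ n, powPair n ∈ LinearMap.range (shifted L₀ l) := by
    have hstep : ∀ n : ℕ, (l + n) • powPair n - (n : ℂ) • powPair (n - 1) ∈
        LinearMap.range (shifted L₀ l) := by
      intro n
      obtain ⟨x, hx, hLx⟩ :=
        exists_of_mem_closure (graph₀.le_topologicalClosure (powPair_mem_graph₀ n))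
      refine ⟨x, ?_⟩
      rw [shifted_apply, hx, hLx]
      module
    have hne : ∀ n : ℕ, l + n ≠ 0 := by
      intro n h
      have := congrArg Complex.re h
      rw [Complex.add_re, Complex.natCast_re, Complex.zero_re] at this
      have : (0 : ℝ) ≤ n := n.cast_nonneg
      linarith
    intro n
    induction n with
    | zero =>
      have h := hstep 0
      rw [Nat.cast_zero, zero_smul, sub_zero] at h
      exact (Submodule.smul_mem_iff _ (by simpa using hne 0)).1 h
    | succ n ih =>
      have h := Submodule.add_mem _ (hstep (n + 1)) (Submodule.smul_mem _ ((n + 1 : ℕ) : ℂ) ih)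
      rw [Nat.add_sub_cancel, sub_add_cancel] at h
      exact (Submodule.smul_mem_iff _ (hne (n + 1))).1 h
  have := topologicalClosure_eq_top hmem
  rw [← Submodule.dense_iff_topologicalClosure_eq_top] at this
  exact this

/-- Dissipativity of `L₀ - 1/2` bounds `λ - L₀` from below. -/
theorem norm_le_norm_shifted {l : ℂ} (x : L₀.domain) :
    (l.re - 1 / 2) * ‖(x : H)‖ ≤ ‖shifted L₀ l x‖ := by
  have h := re_inner_le_of_mem_closure (mem_closure_graph₀ x)
  change (inner ℂ (x : H) (L₀ x)).re ≤ 1 / 2 * ‖(x : H)‖ ^ 2 at h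
  have h1 : (inner ℂ (x : H) (shifted L₀ l x)).re =
      l.re * ‖(x : H)‖ ^ 2 - (inner ℂ (x : H) (L₀ x)).re := by
    rw [shifted_apply, inner_sub_right, inner_smul_right, inner_self_eq_norm_sq_to_K,
      Complex.sub_re]
    congr 1
    norm_cast
    exact Complex.re_mul_ofReal _ _
  have h2 : (inner ℂ (x : H) (shifted L₀ l x)).re ≤ ‖(x : H)‖ * ‖shifted L₀ l x‖ :=
    (Complex.re_le_norm _).trans (norm_inner_le_norm _ _)
  rcases (norm_nonneg (x : H)).eq_or_lt with h0 | h0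
  · rw [← h0, mul_zero]
    exact norm_nonneg _
  · refine le_of_mul_le_mul_left ?_ h0
    nlinarith

/-- The graph is complete, and `(u, v) ↦ λ u - v` is bounded below on it. -/
theorem isClosed_range_shifted {l : ℂ} (hl : 1 / 2 < l.re) :
    IsClosed (range (shifted L₀ l)) := by
  have hd : 0 < l.re - 1 / 2 := sub_pos.2 hl
  have : CompleteSpace graph₀.topologicalClosure :=
    graph₀.isClosed_topologicalClosure.completeSpace_coe
  let T : graph₀.topologicalClosure →L[ℂ] H :=
    (l • ContinuousLinearMap.fst ℂ H H - ContinuousLinearMap.snd ℂ H H).comp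
      graph₀.topologicalClosure.subtypeL
  have hT : range (shifted L₀ l) = range T := by
    ext y
    constructor
    · rintro ⟨x, rfl⟩
      exact ⟨⟨_, mem_closure_graph₀ x⟩, rfl⟩
    · rintro ⟨⟨⟨u, v⟩, h⟩, rfl⟩
      obtain ⟨x, rfl, rfl⟩ := exists_of_mem_closure h
      exact ⟨x, rfl⟩
  -- `T` dominates the first component by dissipativity, hence also the second one
  have hb : ∀ p, ‖p‖ ≤ ((1 + ‖l‖) * (l.re - 1 / 2)⁻¹ + 1) * ‖T p‖ := by
    rintro ⟨⟨u, v⟩, h⟩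
    obtain ⟨x, rfl, rfl⟩ := exists_of_mem_closure h
    have h1 : ‖(x : H)‖ ≤ (l.re - 1 / 2)⁻¹ * ‖l • (x : H) - L₀ x‖ := by
      rw [inv_mul_eq_div, le_div_iff₀' hd]
      exact norm_le_norm_shifted x
    have h2 : ‖L₀ x‖ ≤ ‖l‖ * ‖(x : H)‖ + ‖l • (x : H) - L₀ x‖ := by
      rw [← norm_smul]
      exact norm_le_norm_add_norm_sub _ _
    change max ‖(x : H)‖ ‖L₀ x‖ ≤ _ * ‖l • (x : H) - L₀ x‖
    have h3 := mul_le_mul_of_nonneg_left h1 (norm_nonneg l)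
    have h4 := norm_nonneg (x : H)
    have h5 := norm_nonneg (l • (x : H) - L₀ x)
    have h6 := mul_nonneg (norm_nonneg l) h4
    refine max_le ?_ ?_ <;> linarith
  rw [hT]
  exact (T.antilipschitz_of_bound (K := Real.toNNReal
    ((1 + ‖l‖) * (l.re - 1 / 2)⁻¹ + 1)) (by
      intro p
      rw [Real.coe_toNNReal _ (by positivity)]
      exact hb p)).isClosed_range T.uniformContinuous

theorem mem_resolventSet {l : ℂ} (hl : 1 / 2 < l.re) : l ∈ resolventSet L₀ := by
  have hd : 0 < l.re - 1 / 2 := sub_pos.2 hl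
  have hbij : Function.Bijective (shifted L₀ l) := by
    refine ⟨injective_shifted hl.le, range_eq_univ.1 ?_⟩
    rw [← (isClosed_range_shifted hl).closure_eq]
    exact (denseRange_shifted hl.le).closure_range
  refine ⟨hbij, ?_⟩
  let e := LinearEquiv.ofBijective (shifted L₀ l) hbij
  refine ⟨(L₀.domain.subtype ∘ₗ e.symm.toLinearMap).mkContinuous (l.re - 1 / 2)⁻¹ ?_, ?_⟩
  · intro y
    obtain ⟨x, rfl⟩ := e.surjective y
    have := norm_le_norm_shifted (l := l) x
    rw [inv_mul_eq_div, le_div_iff₀' hd]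
    change (l.re - 1 / 2) * ‖((e.symm (e x) : L₀.domain) : H)‖ ≤ _
    rwa [e.symm_apply_apply]
  · intro x
    change ((e.symm (e x) : L₀.domain) : H) = x
    rw [e.symm_apply_apply]

/-! ### The half-plane `Re λ < 1/2` -/

/-- Dominated convergence in `L²(0,1)`. -/
theorem tendsto_Lp_of_dominated {U : ℕ → Lp ℂ 2 μ01} {u : Lp ℂ 2 μ01} {F : ℕ → ℝ → ℂ}
    {f : ℝ → ℂ} {b : ℝ → ℝ} (hU : ∀ n, U n =ᵐ[μ01] F n) (hu : u =ᵐ[μ01] f)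
    (hb : MemLp b 2 μ01) (hF : ∀ n, ∀ᵐ ρ ∂μ01, ‖F n ρ‖ ≤ b ρ)
    (hlim : ∀ᵐ ρ ∂μ01, Tendsto (fun n => F n ρ) atTop (𝓝 (f ρ))) :
    Tendsto U atTop (𝓝 u) := by
  have hd : ∀ n, ((U n - u : Lp ℂ 2 μ01) : ℝ → ℂ) =ᵐ[μ01] fun ρ => F n ρ - f ρ := fun n =>
    (Lp.coeFn_sub (U n) u).trans ((hU n).sub hu)
  have hfb : ∀ᵐ ρ ∂μ01, ‖f ρ‖ ≤ b ρ := by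
    filter_upwards [hlim, ae_all_iff.2 hF] with ρ h1 h2
    exact le_of_tendsto' h1.norm h2
  have hsq : Tendsto (fun n => ‖U n - u‖ ^ 2) atTop (𝓝 0) := by
    simp_rw [norm_sq_eq_integral (hd _)]
    have h := tendsto_integral_of_dominated_convergence (μ := μ01)
      (F := fun n ρ => ‖F n ρ - f ρ‖ ^ 2) (f := fun _ => (0 : ℝ)) (fun ρ => (2 * b ρ) ^ 2)
      (fun n => ((Lp.aestronglyMeasurable (U n - u)).congr (hd n)).norm.pow 2)
      (hb.const_mul 2).integrable_sq (fun n => ?_) ?_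
    · rwa [integral_zero] at h
    · filter_upwards [hF n, hfb] with ρ h1 h2
      rw [Real.norm_of_nonneg (by positivity)]
      refine pow_le_pow_left₀ (norm_nonneg _) ?_ 2
      linarith [norm_sub_le (F n ρ) (f ρ)]
    · filter_upwards [hlim] with ρ h
      have := ((h.sub_const (f ρ)).norm).pow 2
      simpa using this
  rw [tendsto_iff_norm_sub_tendsto_zero]
  have := hsq.sqrt
  simpa [Real.sqrt_sq (norm_nonneg _)] using this

/-- The function `ρ ↦ (1 + ε - σ ρ) ^ c`. For `ε > 0` it is a smooth approximation of
`(1 - σ ρ) ^ c`. -/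
def shiftPow (c : ℂ) (σ ε ρ : ℝ) : ℂ := ((1 + ε - σ * ρ : ℝ) : ℂ) ^ c

section ShiftPow

variable {c l : ℂ} {σ ε ρ : ℝ}

theorem hasDerivAt_shiftPow (h : 0 < 1 + ε - σ * ρ) :
    HasDerivAt (shiftPow c σ ε) (-(σ * c) * shiftPow (c - 1) σ ε ρ) ρ := by
  have h1 : HasDerivAt (fun ρ : ℝ => ((1 + ε - σ * ρ : ℝ) : ℂ)) ((-σ : ℝ) : ℂ) ρ := by
    have h2 : HasDerivAt (fun ρ : ℝ => 1 + ε - σ * ρ) (-σ) ρ := by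
      simpa using ((hasDerivAt_id ρ).const_mul σ).const_sub (1 + ε)
    exact h2.ofReal_comp
  have h3 := ((hasDerivAt_id (((1 + ε - σ * ρ : ℝ) : ℂ))).cpow_const (c := c)
    (Complex.ofReal_mem_slitPlane.2 h)).comp ρ h1
  refine h3.congr_deriv ?_
  simp only [shiftPow, id]
  push_cast
  ring

theorem shiftPow_add_one (h : 0 < 1 - σ * ρ) :
    (1 - σ * ρ) * shiftPow c σ 0 ρ = shiftPow (c + 1) σ 0 ρ := by
  have h0 : ((1 + 0 - σ * ρ : ℝ) : ℂ) ≠ 0 := by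
    rw [add_zero]
    exact_mod_cast h.ne'
  rw [shiftPow, shiftPow, Complex.cpow_add _ _ h0, Complex.cpow_one]
  push_cast
  ring

theorem tendsto_shiftPow {e : ℕ → ℝ} (he : Tendsto e atTop (𝓝 0)) (h : 0 < 1 - σ * ρ) :
    Tendsto (fun n => shiftPow c σ (e n) ρ) atTop (𝓝 (shiftPow c σ 0 ρ)) := by
  have h1 : ContinuousAt (fun ε : ℝ => shiftPow c σ ε ρ) 0 := by
    refine ContinuousAt.cpow ?_ continuousAt_const
      (Complex.ofReal_mem_slitPlane.2 (by linarith))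
    fun_prop
  exact h1.tendsto.comp he

/-- A square integrable bound, for `Re λ < 1/2`, of the functions `(1 + ε - σ ρ) ^ (-λ)` with
`|σ| ≤ 1` and `0 ≤ ε ≤ 1`: a power is monotone on `[1 - ρ, 3]`. -/
def powBound (l : ℂ) (ρ : ℝ) : ℝ := (1 - ρ) ^ (-l.re) + 3 ^ (-l.re)

theorem memLp_powBound (hl : l.re < 1 / 2) : MemLp (powBound l) 2 μ01 := by
  refine MemLp.add ?_ (memLp_const _)
  have hm : Measurable fun ρ : ℝ => (1 - ρ) ^ (-l.re) := by fun_prop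
  rw [memLp_two_iff_integrable_sq hm.aestronglyMeasurable]
  have h := ((intervalIntegral.intervalIntegrable_rpow' (a := 0) (b := 1) (r := -l.re * 2)
    (by linarith)).comp_sub_left 1).symm
  rw [sub_zero, sub_self, intervalIntegrable_iff_integrableOn_Ioo_of_le zero_le_one] at h
  refine Integrable.congr h ?_
  filter_upwards [ae_mem] with ρ hρ
  rw [Real.rpow_mul (by linarith [hρ.2])]
  norm_cast

theorem norm_shiftPow_le (hσ : |σ| ≤ 1) (hε : 0 ≤ ε) (hε' : ε ≤ 1) (hρ : ρ ∈ Ioo (0 : ℝ) 1) :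
    ‖shiftPow (-l) σ ε ρ‖ ≤ powBound l ρ := by
  obtain ⟨s1, s2⟩ := abs_le.1 hσ
  have hlo : 1 - ρ ≤ 1 + ε - σ * ρ := by nlinarith [hρ.1]
  have hhi : 1 + ε - σ * ρ ≤ 3 := by nlinarith [hρ.1, hρ.2]
  have h0 : 0 < 1 - ρ := by linarith [hρ.2]
  have p1 := Real.rpow_nonneg h0.le (-l.re)
  have p2 : (0 : ℝ) ≤ 3 ^ (-l.re) := by positivity
  rw [shiftPow, Complex.norm_cpow_eq_rpow_re_of_pos (h0.trans_le hlo), Complex.neg_re, powBound]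
  rcases le_total 0 (-l.re) with h | h
  · linarith [Real.rpow_le_rpow (h0.trans_le hlo).le hhi h]
  · linarith [Real.rpow_le_rpow_of_nonpos h0 hlo h]

theorem norm_mul_shiftPow_le (hσ : |σ| ≤ 1) (hε : 0 ≤ ε) (hε' : ε ≤ 1)
    (hρ : ρ ∈ Ioo (0 : ℝ) 1) :
    ‖(1 - σ * ρ) * shiftPow (-l - 1) σ ε ρ‖ ≤ powBound l ρ := by
  refine le_trans ?_ (norm_shiftPow_le hσ hε hε' hρ)
  obtain ⟨s1, s2⟩ := abs_le.1 hσ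
  have h1 : 0 < 1 - σ * ρ := by nlinarith [hρ.1, hρ.2]
  have h2 : 0 < 1 + ε - σ * ρ := by linarith
  have e1 : ‖(1 - σ * ρ : ℂ)‖ = 1 - σ * ρ := by
    have : (1 - σ * ρ : ℂ) = ((1 - σ * ρ : ℝ) : ℂ) := by push_cast; ring
    rw [this, Complex.norm_real, Real.norm_of_nonneg h1.le]
  rw [norm_mul, e1, shiftPow, shiftPow, Complex.norm_cpow_eq_rpow_re_of_pos h2,
    Complex.norm_cpow_eq_rpow_re_of_pos h2, Complex.sub_re, Complex.one_re,
    Real.rpow_sub_one h2.ne', mul_div_assoc', div_le_iff₀ h2, mul_comm]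
  exact mul_le_mul_of_nonneg_left (by linarith) (Real.rpow_nonneg h2.le _)

theorem memLp_shiftPow (hl : l.re < 1 / 2) (hσ : |σ| ≤ 1) (hε : 0 ≤ ε) (hε' : ε ≤ 1) :
    MemLp (shiftPow (-l) σ ε) 2 μ01 := by
  refine (memLp_powBound hl).mono' ?_ ?_
  · have : Measurable (shiftPow (-l) σ ε) := by unfold shiftPow; fun_prop
    exact this.aestronglyMeasurable
  · filter_upwards [ae_restrict_mem measurableSet_Ioo] with ρ hρ
    exact norm_shiftPow_le hσ hε hε' hρ

theorem memLp_mul_shiftPow (hl : l.re < 1 / 2) (hσ : |σ| ≤ 1) (hε : 0 ≤ ε) (hε' : ε ≤ 1) :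
    MemLp (fun ρ : ℝ => (1 - σ * ρ) * shiftPow (-l - 1) σ ε ρ) 2 μ01 := by
  refine (memLp_powBound hl).mono' ?_ ?_
  · have : Measurable fun ρ : ℝ => (1 - σ * ρ) * shiftPow (-l - 1) σ ε ρ := by
      unfold shiftPow; fun_prop
    exact this.aestronglyMeasurable
  · filter_upwards [ae_restrict_mem measurableSet_Ioo] with ρ hρ
    exact norm_mul_shiftPow_le hσ hε hε' hρ

theorem isC1_shiftPow (hσ : |σ| ≤ 1) (hε : 0 < ε) : IsC1 (shiftPow c σ ε) := by
  obtain ⟨s1, s2⟩ := abs_le.1 hσ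
  have hpos : ∀ ρ ∈ Icc (0 : ℝ) 1, 0 < 1 + ε - σ * ρ := fun ρ hρ => by nlinarith [hρ.1, hρ.2]
  have hcont : ∀ c : ℂ, ContinuousOn (shiftPow c σ ε) (Icc 0 1) := fun c ρ hρ =>
    (hasDerivAt_shiftPow (hpos ρ hρ)).continuousAt.continuousWithinAt
  refine (contDiffOn_one_iff_derivWithin (uniqueDiffOn_Icc zero_lt_one)).2
    ⟨fun ρ hρ => (hasDerivAt_shiftPow (hpos ρ hρ)).differentiableAt.differentiableWithinAt, ?_⟩
  exact (continuousOn_const.mul (hcont (c - 1))).congr fun ρ hρ =>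
    D_eq_of_hasDerivAt hρ (hasDerivAt_shiftPow (hpos ρ hρ))

end ShiftPow

/-- The element `(c (a - b), c (a + b))` of `H`. -/
def mix (c : ℂ) (a b : Lp ℂ 2 μ01) : H := WithLp.toLp 2 (c • (a - b), c • (a + b))

theorem represents_mix {c : ℂ} {a b : Lp ℂ 2 μ01} {f g : ℝ → ℂ} (ha : a =ᵐ[μ01] f)
    (hb : b =ᵐ[μ01] g) :
    Represents (fun ρ => c * (f ρ - g ρ)) (fun ρ => c * (f ρ + g ρ)) (mix c a b) := by
  refine ⟨?_, ?_⟩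
  · exact (Lp.coeFn_smul c (a - b)).trans (((Lp.coeFn_sub a b).trans (ha.sub hb)).const_smul c)
  · exact (Lp.coeFn_smul c (a + b)).trans (((Lp.coeFn_add a b).trans (ha.add hb)).const_smul c)

theorem tendsto_mix {c : ℂ} {a b : ℕ → Lp ℂ 2 μ01} {a' b' : Lp ℂ 2 μ01}
    (ha : Tendsto a atTop (𝓝 a')) (hb : Tendsto b atTop (𝓝 b')) :
    Tendsto (fun n => mix c (a n) (b n)) atTop (𝓝 (mix c a' b')) :=
  ((WithLp.prod_continuous_toLp 2 _ _).tendsto _).comp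
    (((ha.sub hb).const_smul c).prodMk_nhds ((ha.add hb).const_smul c))

theorem mix_mem_graph₀ {l : ℂ} {ε : ℝ} (hε : 0 < ε) {a b a' b' : Lp ℂ 2 μ01}
    (ha : a =ᵐ[μ01] shiftPow (-l) 1 ε) (hb : b =ᵐ[μ01] shiftPow (-l) (-1) ε)
    (ha' : a' =ᵐ[μ01] fun ρ => (1 - (1 : ℝ) * ρ) * shiftPow (-l - 1) 1 ε ρ)
    (hb' : b' =ᵐ[μ01] fun ρ => (1 - (-1 : ℝ) * ρ) * shiftPow (-l - 1) (-1) ε ρ) :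
    (mix (l - 1) a b, mix ((l - 1) * l) a' b') ∈ graph₀ := by
  have s1 : |(1 : ℝ)| ≤ 1 := by simp
  have s2 : |(-1 : ℝ)| ≤ 1 := by simp
  have c1 : IsC1 (shiftPow (-l) 1 ε) := isC1_shiftPow s1 hε
  have c2 : IsC1 (shiftPow (-l) (-1) ε) := isC1_shiftPow s2 hε
  have hD : ∀ ρ ∈ Icc (0 : ℝ) 1,
      D (fun ρ => (l - 1) * (shiftPow (-l) 1 ε ρ - shiftPow (-l) (-1) ε ρ)) ρ =
        (l - 1) * l * (shiftPow (-l - 1) 1 ε ρ + shiftPow (-l - 1) (-1) ε ρ) ∧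
      D (fun ρ => (l - 1) * (shiftPow (-l) 1 ε ρ + shiftPow (-l) (-1) ε ρ)) ρ =
        (l - 1) * l * (shiftPow (-l - 1) 1 ε ρ - shiftPow (-l - 1) (-1) ε ρ) := by
    intro ρ hρ
    have d1 := hasDerivAt_shiftPow (c := -l) (σ := 1) (ε := ε) (ρ := ρ) (by linarith [hρ.2])
    have d2 := hasDerivAt_shiftPow (c := -l) (σ := -1) (ε := ε) (ρ := ρ) (by linarith [hρ.1])
    refine ⟨D_eq_of_hasDerivAt hρ (((d1.fun_sub d2).const_mul (l - 1)).congr_deriv ?_),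
      D_eq_of_hasDerivAt hρ (((d1.fun_add d2).const_mul (l - 1)).congr_deriv ?_)⟩ <;>
    · push_cast
      ring
  refine ⟨_, _, contDiffOn_const.mul (c1.sub c2), contDiffOn_const.mul (c1.add c2), ?_,
    represents_mix ha hb, (represents_mix ha' hb').congr ?_ ?_⟩
  · simp [shiftPow]
  · intro ρ hρ
    rw [ell₁, (hD ρ hρ).1, (hD ρ hρ).2]
    push_cast
    ring
  · intro ρ hρ
    rw [ell₂, (hD ρ hρ).1, (hD ρ hρ).2]
    push_cast
    ring

/-- The representatives prescribed by `u₀`, simplified on `(0,1)`. -/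
theorem eigenfunction_eq {l : ℂ} {ρ : ℝ} (hρ : ρ ∈ Ioo (0 : ℝ) 1) :
    (ρ : ℂ) * deriv (u₀ l) ρ + (l - 1) * u₀ l ρ =
        (l - 1) * (shiftPow (-l) 1 0 ρ - shiftPow (-l) (-1) 0 ρ) ∧
      deriv (u₀ l) ρ = (l - 1) * (shiftPow (-l) 1 0 ρ + shiftPow (-l) (-1) 0 ρ) := by
  have p1 : 0 < 1 - 1 * ρ := by linarith [hρ.2]
  have p2 : 0 < 1 - -1 * ρ := by linarith [hρ.1]
  have e : u₀ l = fun ρ => shiftPow (1 - l) 1 0 ρ - shiftPow (1 - l) (-1) 0 ρ := by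
    funext ρ
    simp [u₀, shiftPow]
  have d1 := hasDerivAt_shiftPow (c := 1 - l) (σ := 1) (ε := 0) (ρ := ρ) (by linarith)
  have d2 := hasDerivAt_shiftPow (c := 1 - l) (σ := -1) (ε := 0) (ρ := ρ) (by linarith)
  have hd : deriv (u₀ l) ρ = (l - 1) * (shiftPow (-l) 1 0 ρ + shiftPow (-l) (-1) 0 ρ) := by
    rw [e, (d1.fun_sub d2).deriv, show 1 - l - 1 = -l by ring]
    push_cast
    ring
  refine ⟨?_, hd⟩
  have q1 := shiftPow_add_one (c := -l) p1
  have q2 := shiftPow_add_one (c := -l) p2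
  rw [neg_add_eq_sub] at q1 q2
  rw [hd, e]
  beta_reduce
  rw [← q1, ← q2]
  push_cast
  ring

/-- For `Re λ < 1/2` the pair given by `u₀` is an eigenvector: it is the limit, in the graph
norm, of the pairs obtained by replacing `1 ∓ ρ` with `1 + ε ∓ ρ`. -/
theorem exists_eigenvector {l : ℂ} (hl : l.re < 1 / 2) :
    ∃ u : L₀.domain, u ≠ 0 ∧ L₀ u = l • (u : H) ∧
      Represents (fun ρ => (ρ : ℂ) * deriv (u₀ l) ρ + (l - 1) * u₀ l ρ)
        (fun ρ => deriv (u₀ l) ρ) (u : H) := by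
  have s1 : |(1 : ℝ)| ≤ 1 := by simp
  have s2 : |(-1 : ℝ)| ≤ 1 := by simp
  let e : ℕ → ℝ := fun n => 1 / ((n : ℝ) + 1)
  have e0 : ∀ n, 0 < e n := fun n => Nat.one_div_pos_of_nat
  have e1 : ∀ n, e n ≤ 1 := fun n => by
    simpa [e] using Nat.one_div_le_one_div (α := ℝ) n.zero_le
  have he : Tendsto e atTop (𝓝 0) := tendsto_one_div_add_atTop_nhds_zero_nat
  let A (σ : ℝ) (hσ : |σ| ≤ 1) : Lp ℂ 2 μ01 :=
    (memLp_shiftPow hl hσ le_rfl zero_le_one).toLp _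
  let B (σ : ℝ) (hσ : |σ| ≤ 1) (n : ℕ) : Lp ℂ 2 μ01 :=
    (memLp_shiftPow hl hσ (e0 n).le (e1 n)).toLp _
  let C (σ : ℝ) (hσ : |σ| ≤ 1) (n : ℕ) : Lp ℂ 2 μ01 :=
    (memLp_mul_shiftPow hl hσ (e0 n).le (e1 n)).toLp _
  have hA : ∀ σ hσ, A σ hσ =ᵐ[μ01] shiftPow (-l) σ 0 := fun σ hσ => MemLp.coeFn_toLp _
  have hB : ∀ σ hσ n, B σ hσ n =ᵐ[μ01] shiftPow (-l) σ (e n) := fun σ hσ n => MemLp.coeFn_toLp _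
  have hC : ∀ σ hσ n, C σ hσ n =ᵐ[μ01] fun ρ => (1 - σ * ρ) * shiftPow (-l - 1) σ (e n) ρ :=
    fun σ hσ n => MemLp.coeFn_toLp _
  have hpos : ∀ σ : ℝ, |σ| ≤ 1 → ∀ ρ ∈ Ioo (0 : ℝ) 1, 0 < 1 - σ * ρ := fun σ hσ ρ hρ => by
    nlinarith [(abs_le.1 hσ).2, hρ.1, hρ.2]
  have tB : ∀ σ hσ, Tendsto (B σ hσ) atTop (𝓝 (A σ hσ)) := by
    intro σ hσ
    refine tendsto_Lp_of_dominated (hB σ hσ) (hA σ hσ) (memLp_powBound hl) (fun n => ?_) ?_ <;>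
      filter_upwards [ae_restrict_mem measurableSet_Ioo] with ρ hρ
    · exact norm_shiftPow_le hσ (e0 n).le (e1 n) hρ
    · exact tendsto_shiftPow he (hpos σ hσ ρ hρ)
  have tC : ∀ σ hσ, Tendsto (C σ hσ) atTop (𝓝 (A σ hσ)) := by
    intro σ hσ
    refine tendsto_Lp_of_dominated (hC σ hσ) (hA σ hσ) (memLp_powBound hl) (fun n => ?_) ?_ <;>
      filter_upwards [ae_restrict_mem measurableSet_Ioo] with ρ hρ
    · exact norm_mul_shiftPow_le hσ (e0 n).le (e1 n) hρ
    · have h := (tendsto_shiftPow (c := -l - 1) he (hpos σ hσ ρ hρ)).const_mul (1 - σ * ρ : ℂ)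
      rwa [shiftPow_add_one (hpos σ hσ ρ hρ), sub_add_cancel] at h
  have hmem : (mix (l - 1) (A 1 s1) (A (-1) s2), mix ((l - 1) * l) (A 1 s1) (A (-1) s2)) ∈
      graph₀.topologicalClosure :=
    mem_closure_of_tendsto
      ((tendsto_mix (tB 1 s1) (tB (-1) s2)).prodMk_nhds (tendsto_mix (tC 1 s1) (tC (-1) s2)))
      (Eventually.of_forall fun n =>
        mix_mem_graph₀ (e0 n) (hB 1 s1 n) (hB (-1) s2 n) (hC 1 s1 n) (hC (-1) s2 n))
  obtain ⟨u, hu, hLu⟩ := exists_of_mem_closure hmem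
  have hrep := represents_mix (c := l - 1) (hA 1 s1) (hA (-1) s2)
  rw [← hu] at hrep
  refine ⟨u, ?_, ?_, ?_⟩
  · rintro rfl
    have z1 : ((0 : Lp ℂ 2 μ01) : ℝ → ℂ) =ᵐ[μ01] _ := hrep.1
    have z2 : ((0 : Lp ℂ 2 μ01) : ℝ → ℂ) =ᵐ[μ01] _ := hrep.2
    have : NeBot (ae μ01) := ae_neBot.2 (by simp [Measure.restrict_eq_zero])
    have hex : ∀ᵐ ρ ∂μ01, False := by
      filter_upwards [z1, z2, Lp.coeFn_zero ℂ 2 μ01, ae_restrict_mem measurableSet_Ioo]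
        with ρ h1 h2 h0 hρ
      rw [h0] at h1 h2
      have h3 : (l - 1) * shiftPow (-l) 1 0 ρ = 0 := by
        simp only [Pi.zero_apply] at h1 h2
        linear_combination -(1 / 2) * h1 - (1 / 2) * h2
      rcases mul_eq_zero.1 h3 with h | h
      · have := congrArg Complex.re h
        simp only [Complex.sub_re, Complex.one_re, Complex.zero_re] at this
        linarith
      · have hp := hpos 1 s1 ρ hρ
        have := congrArg norm h
        rw [shiftPow, Complex.norm_cpow_eq_rpow_re_of_pos (by linarith), norm_zero] at this
        exact (Real.rpow_pos_of_pos (by linarith) _).ne' this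
    exact hex.exists.choose_spec
  · rw [hLu, hu]
    refine WithLp.ofLp_injective 2 (Prod.ext ?_ ?_)
    · change ((l - 1) * l) • (A 1 s1 - A (-1) s2) = l • (l - 1) • (A 1 s1 - A (-1) s2)
      rw [smul_smul, mul_comm]
    · change ((l - 1) * l) • (A 1 s1 + A (-1) s2) = l • (l - 1) • (A 1 s1 + A (-1) s2)
      rw [smul_smul, mul_comm]
  · refine ⟨hrep.1.trans ?_, hrep.2.trans ?_⟩ <;>
      filter_upwards [ae_restrict_mem measurableSet_Ioo] with ρ hρ
    · exact (eigenfunction_eq hρ).1.symm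
    · exact (eigenfunction_eq hρ).2.symm

theorem not_injective_shifted {l : ℂ} (hl : l.re < 1 / 2) :
    ¬ Function.Injective (shifted L₀ l) := by
  obtain ⟨u, hu, hLu, -⟩ := exists_eigenvector hl
  intro h
  refine hu (h ?_)
  rw [map_zero, shifted_apply, hLu, sub_self]

/-- An eigenvector for `m` near `l` is an approximate eigenvector for `l`, so the critical line
belongs to the spectrum. -/
theorem notMem_resolventSet_of_re_eq {l : ℂ} (hl : l.re = 1 / 2) : l ∉ resolventSet L₀ := by
  rintro ⟨-, R, hR⟩
  set δ : ℝ := 1 / (2 * (‖R‖ + 1)) with hδ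
  have hR0 : 0 < ‖R‖ + 1 := by positivity
  have hδ0 : 0 < δ := by positivity
  obtain ⟨u, hu, hLu, -⟩ := exists_eigenvector (l := l - δ) (by
    rw [Complex.sub_re, Complex.ofReal_re]
    linarith)
  have hs : shifted L₀ l u = (δ : ℂ) • (u : H) := by
    rw [shifted_apply, hLu, ← sub_smul, sub_sub_cancel]
  have h1 := hR u
  have hu0 : 0 < ‖(u : H)‖ := norm_pos_iff.2 fun h => hu (Subtype.ext h)
  have h2 : ‖(u : H)‖ ≤ ‖R‖ * (δ * ‖(u : H)‖) := by
    have := R.le_opNorm (shifted L₀ l u)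
    rwa [h1, hs, norm_smul, Complex.norm_real, Real.norm_of_nonneg hδ0.le] at this
  have h3 : ‖R‖ * δ < 1 := by
    rw [hδ, mul_one_div, div_lt_one (by positivity)]
    linarith [norm_nonneg R]
  nlinarith

theorem mem_spectrum_iff {l : ℂ} : l ∈ spectrum L₀ ↔ l.re ≤ 1 / 2 := by
  constructor
  · intro h
    by_contra! hlt
    exact h (mem_resolventSet hlt)
  · intro h
    rcases h.lt_or_eq with h | h
    · exact fun hr => not_injective_shifted h hr.1.injective
    · exact notMem_resolventSet_of_re_eq h

theorem injective_shifted_iff {l : ℂ} :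
    Function.Injective (shifted L₀ l) ↔ 1 / 2 ≤ l.re :=
  ⟨fun h => not_lt.1 fun hlt => not_injective_shifted hlt h, injective_shifted⟩

end FreeWave

end

theorem mainTheorem5 :
    FreeWave.L₀tilde.IsClosable ∧
    FreeWave.spectrum FreeWave.L₀ = {l : ℂ | l.re ≤ 1 / 2} ∧
    FreeWave.pointSpectrum FreeWave.L₀ = {l : ℂ | l.re < 1 / 2} ∧
    FreeWave.continuousSpectrum FreeWave.L₀ = {l : ℂ | l.re = 1 / 2} ∧
    FreeWave.residualSpectrum FreeWave.L₀ = ∅ ∧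
    (∀ l : ℂ, l.re < 1 / 2 →
      ∃ u : FreeWave.L₀.domain, u ≠ 0 ∧ FreeWave.L₀ u = l • (u : FreeWave.H) ∧
        FreeWave.Represents
          (fun ρ => (ρ : ℂ) * deriv (FreeWave.u₀ l) ρ + (l - 1) * FreeWave.u₀ l ρ)
          (fun ρ => deriv (FreeWave.u₀ l) ρ)
          (u : FreeWave.H)) := by
  refine ⟨FreeWave.isClosable_L₀tilde, ?_, ?_, ?_, ?_, fun l hl => FreeWave.exists_eigenvector hl⟩
  · ext l
    exact FreeWave.mem_spectrum_iff
  · ext l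
    exact FreeWave.injective_shifted_iff.not.trans not_le
  · ext l
    constructor
    · rintro ⟨h1, h2, -⟩
      exact le_antisymm (FreeWave.mem_spectrum_iff.1 h1) (FreeWave.injective_shifted_iff.1 h2)
    · intro h
      exact ⟨FreeWave.mem_spectrum_iff.2 (le_of_eq h), FreeWave.injective_shifted (ge_of_eq h),
        FreeWave.denseRange_shifted (ge_of_eq h)⟩
  · refine eq_empty_of_forall_notMem ?_
    rintro l ⟨h1, h2⟩
    exact h2 (FreeWave.denseRange_shifted (FreeWave.injective_shifted_iff.1 h1))
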